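/- Let $A$ be an alphabet. The J expressions over $A$, and the languages that they define, are given inductively as follows. (1) $\epsilon$ is a J expression, and so is each $a\in A$; they define $\{\epsilon\}$ and $\{a\}$. (2) If $\alpha,\beta$ are J expressions, so is $(\alpha\cup\beta)$, which defines $L(\alpha)\cup L(\beta)$. (3) If $\alpha,\beta$ are J expressions, neither of which is the expression $\epsilon$, then $(\alpha\beta)$ and $(\alpha^+)$ are J expressions; they define $L(\alpha)L(\beta)$ and $\bigcup_{i\ge 1}L(\alpha)^i$. (4) If $k\ge 1$, if $\beta_1,\dots,\beta_k$ are J expressions that contain neither the operator union nor the operator positive closure, and if each $n_j$ is either a fixed positive integer or an integer variable (the same variable may occur several times), then the exponentiation $\beta_1^{n_1}\cdots\beta_k^{n_k}$ is a J expression; it defines the union, over all assignments of positive integers to the variables, of $L(\beta_1)^{n_1}\cdots L(\beta_k)^{n_k}$. A J language is a language defined by a J expression. A one-way $\log n$ space-bounded NTM is a nondeterministic Turing machine with a one-way read-only input tape and a read-write work tape that accepts each word of its language, of length $n$ say, by some computation that scans $O(\log n)$ cells of the work tape (at most $C(\lfloor\log_2 n\rfloor+1)$ cells, with $C$ independent of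 the word). A linear-space multicounter machine is a one-way nondeterministic finite automaton with finitely many counters, initially zero, each of which can in each step be incremented or decremented by $1$ and tested for zero; it accepts a word $w$ if some computation during which no counter exceeds the length of $w$ reads all of $w$ and ends in a final state with all counters zero. **Corollary.** There are context-free languages that are not J languages. Namely, let $L=\{x\#x^R : x\in\{0,1\}^+\}$, a language over the alphabet $\{0,1,\#\}$, where $x^R$ is the reverse of $x$. Then (a) $L$ is context-free; (b) $L$ is not a J language; (c) $L$ is not accepted by any one-way $\log n$ space-bounded NTM; (d) $L$ is not accepted by any linear-space multicounter machine. -/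

import Mathlib

/-- An exponent in an exponentiation: a fixed positive integer, or an integer variable
(variables are named by natural numbers). -/
inductive JExponent : Type
  | const (n : ℕ+) : JExponent
  | var (v : ℕ) : JExponent

/-- The positive integer denoted by an exponent when the variables have the values `ν`. -/
def JExponent.val (ν : ℕ → ℕ+) : JExponent → ℕ
  | .const n => (n : ℕ)
  | .var v => (ν v : ℕ)

/-- Raw expressions over the alphabet `A`. The constructor `expo k β n` is the
exponentiation `β₀ ^ n₀ β₁ ^ n₁ ⋯ βₖ ^ nₖ` with `k + 1 ≥ 1` exponentiation-terms; equal
variables among the `n j` stand for equal exponents. -/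
inductive JExpr (A : Type) : Type
  | eps : JExpr A
  | sym (a : A) : JExpr A
  | union (α β : JExpr A) : JExpr A
  | concat (α β : JExpr A) : JExpr A
  | plus (α : JExpr A) : JExpr A
  | expo (k : ℕ) (β : Fin (k + 1) → JExpr A) (n : Fin (k + 1) → JExponent) : JExpr A

namespace JExpr

/-- The expression contains neither the operator union nor the operator positive closure. -/
def UnionPlusFree {A : Type} : JExpr A → Prop
  | eps => True
  | sym _ => True
  | union _ _ => False
  | concat α β => α.UnionPlusFree ∧ β.UnionPlusFree
  | plus _ => False
  | expo _ β _ => ∀ j, (β j).UnionPlusFree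

/-- The raw expression is a J expression: concatenation and positive closure are not applied
to the expression `ε` itself, and exponentiation-terms contain neither union nor positive
closure. -/
def IsJ {A : Type} : JExpr A → Prop
  | eps => True
  | sym _ => True
  | union α β => α.IsJ ∧ β.IsJ
  | concat α β => (α.IsJ ∧ α ≠ eps) ∧ (β.IsJ ∧ β ≠ eps)
  | plus α => α.IsJ ∧ α ≠ eps
  | expo _ β _ => ∀ j, (β j).IsJ ∧ (β j).UnionPlusFree

/-- The language defined by an expression. For an exponentiation it is the union, over all
assignments `ν` of positive integers to the variables, of the products
`L(β₀) ^ n₀ ⋯ L(βₖ) ^ nₖ`. -/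
def language {A : Type} : JExpr A → Language A
  | eps => 1
  | sym a => {[a]}
  | union α β => α.language + β.language
  | concat α β => α.language * β.language
  | plus α => α.language * KStar.kstar α.language
  | expo _ β n =>
      {w | ∃ ν : ℕ → ℕ+, w ∈ (List.ofFn fun j => (β j).language ^ (n j).val ν).prod}

end JExpr

/-- A J language is a language defined by a J expression. -/
def IsJLanguage {A : Type} (L : Language A) : Prop :=
  ∃ α : JExpr A, α.IsJ ∧ α.language = L

/-- A nondeterministic Turing machine with a one-way read-only input tape over `A` and one
two-way infinite read-write work tape. In one step it reads the scanned input symbol (`none`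
is the right endmarker) and the scanned work symbol; a member `(q, b, m, adv)` of `trans`
means: enter state `q`, write `b`, move the work head by `m ∈ {-1, 0, 1}`, and move the input
head one cell to the right iff `adv = true`. -/
structure OneWayNTM (A : Type) where
  State : Type
  Work : Type
  finiteState : Finite State
  finiteWork : Finite Work
  blank : Work
  start : State
  accepting : Set State
  trans : State → Option A → Work → Set (State × Work × SignType × Bool)

namespace OneWayNTM

/-- A configuration: the state, the part of the input from the input head onwards, the work
tape, and the position of the work head. -/
structure Config {A : Type} (M : OneWayNTM A) where
  state : M.State
  rest : List A
  tape : ℤ → M.Work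
  head : ℤ

/-- The initial configuration on the input `w`. -/
def initial {A : Type} (M : OneWayNTM A) (w : List A) : M.Config :=
  ⟨M.start, w, fun _ => M.blank, 0⟩

/-- The one-step relation. On the endmarker the input head does not move. -/
def Step {A : Type} (M : OneWayNTM A) (C D : M.Config) : Prop :=
  ∃ (b : M.Work) (m : SignType) (adv : Bool),
    (D.state, b, m, adv) ∈ M.trans C.state C.rest.head? (C.tape C.head) ∧
    D.rest = (if adv then C.rest.tail else C.rest) ∧
    D.tape = Function.update C.tape C.head b ∧
    D.head = C.head + (m : ℤ)

/-- `c 0, …, c t` is an accepting computation on the input `w`. -/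
def IsAcceptingRun {A : Type} (M : OneWayNTM A) (w : List A) (t : ℕ) (c : ℕ → M.Config) :
    Prop :=
  c 0 = M.initial w ∧ (∀ i < t, M.Step (c i) (c (i + 1))) ∧ (c t).state ∈ M.accepting

/-- The number of work-tape cells scanned in `c 0, …, c t`. -/
def cellsUsed {A : Type} {M : OneWayNTM A} (t : ℕ) (c : ℕ → M.Config) : ℕ :=
  ((Finset.range (t + 1)).image fun i => (c i).head).card

/-- The language accepted by the machine. -/
def language {A : Type} (M : OneWayNTM A) : Language A :=
  {w | ∃ t c, M.IsAcceptingRun w t c}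

/-- `M` accepts `L` in space `O(log n)`: its language is `L`, and every word of `L`, of length
`n` say, has an accepting computation that scans at most `C * (⌊log₂ n⌋ + 1)` work cells,
where `C` does not depend on the word. (Machines all of whose computations obey such a bound
are a special case.) -/
def AcceptsInLogSpace {A : Type} (M : OneWayNTM A) (L : Language A) : Prop :=
  M.language = L ∧
    ∃ C : ℕ, ∀ w ∈ L, ∃ t c, M.IsAcceptingRun w t c ∧
      cellsUsed t c ≤ C * (Nat.log 2 w.length + 1)

end OneWayNTM

/-- A one-way nondeterministic finite automaton over `A` with `k` counters. Depending on the
state and on which counters are zero (`z i = true` iff counter `i` is zero), a member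
`(o, q, δ)` of `trans` means: read the input symbol `a` if `o = some a` and nothing if
`o = none`, enter state `q`, and add `δ i ∈ {-1, 0, 1}` to counter `i`. -/
structure LinearCounterMachine (A : Type) where
  State : Type
  finiteState : Finite State
  k : ℕ
  start : State
  final : Set State
  trans : State → (Fin k → Bool) → Set (Option A × State × (Fin k → SignType))

namespace LinearCounterMachine

/-- A configuration: the state, the unread part of the input, the values of the counters. -/
structure Config {A : Type} (M : LinearCounterMachine A) where
  state : M.State
  rest : List A
  counter : Fin M.k → ℕ

/-- The initial configuration on the input `w`: all counters are zero. -/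
def initial {A : Type} (M : LinearCounterMachine A) (w : List A) : M.Config :=
  ⟨M.start, w, fun _ => 0⟩

/-- The one-step relation; a counter that is zero cannot be decremented. -/
def Step {A : Type} (M : LinearCounterMachine A) (C D : M.Config) : Prop :=
  ∃ (o : Option A) (δ : Fin M.k → SignType),
    (o, D.state, δ) ∈ M.trans C.state (fun i => decide (C.counter i = 0)) ∧
    C.rest = o.toList ++ D.rest ∧
    ∀ i, (D.counter i : ℤ) = (C.counter i : ℤ) + (δ i : ℤ)

/-- The language accepted: the words `w` with a computation during which no counter ever
exceeds the length of `w`, and which ends in a final state with the whole input read and all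
counters zero. -/
def language {A : Type} (M : LinearCounterMachine A) : Language A :=
  {w | ∃ (t : ℕ) (c : ℕ → M.Config),
    c 0 = M.initial w ∧
    (∀ i < t, M.Step (c i) (c (i + 1))) ∧
    (∀ i ≤ t, ∀ j, (c i).counter j ≤ w.length) ∧
    (c t).state ∈ M.final ∧ (c t).rest = [] ∧ ∀ j, (c t).counter j = 0}

end LinearCounterMachine

/-- The language `{x # xᴿ : x ∈ {0,1}⁺}` over the alphabet `{0, 1, #}`, where `0`, `1` and `#`
are `some false`, `some true` and `none`. -/
def markedPalindromes : Language (Option Bool) :=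
  {w | ∃ x : List Bool, x ≠ [] ∧ w = x.map some ++ [none] ++ x.reverse.map some}

/-! The argument counts rectangles, that is, products `P * Q` contained in the language. Each of the
three models is weak in the same way: at any cut `u ++ v` of an accepted word, what the left half
passes to the right half takes polynomially many values in the length bound `m`. Hence polynomially
many rectangles capture all cuts of all words of length at most `m` (`HasPolyCovers`).

For machines the information is a configuration without its unread input: logarithmic space or
linearly bounded counters leave polynomially many (`OneWayNTM.AcceptsInLogSpace.hasPolyCovers`,
`LinearCounterMachine.hasPolyCovers_language`). For J expressions the covers are built by induction
(`JExpr.IsJ.hasPolyCovers`). The delicate case is exponentiation, where only polynomially many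
tuples of exponents matter for short words.

Marked palindromes violate this. Cut `x # xᴿ` just before `#`: two distinct `x` of length `n` cannot
share a rectangle, so at least `2 ^ n` are needed (`two_pow_le_of_hasRectangleCover`).
Context-freeness comes from the grammar `S → bSb | b#b`. -/

/-! ### Polynomial growth -/

/-- A function on the natural numbers that grows at most polynomially. -/
def PolyBounded (f : ℕ → ℕ) : Prop :=
  ∃ d, ∀ m, f m ≤ (m + 2) ^ d

namespace PolyBounded

theorem mono {f g : ℕ → ℕ} (hg : PolyBounded g) (h : ∀ m, f m ≤ g m) : PolyBounded f :=
  hg.imp fun _ hd m => (h m).trans (hd m)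

theorem const (c : ℕ) : PolyBounded fun _ => c :=
  -- The base `m + 2` is at least 2 even at `m = 0`, so a large exponent absorbs any constant.
  ⟨c, fun m => Nat.lt_two_pow_self.le.trans (Nat.pow_le_pow_left (by omega) c)⟩

theorem id : PolyBounded fun m => m :=
  ⟨1, fun m => by simp⟩

theorem add {f g : ℕ → ℕ} (hf : PolyBounded f) (hg : PolyBounded g) :
    PolyBounded fun m => f m + g m := by
  obtain ⟨d, hd⟩ := hf
  obtain ⟨e, he⟩ := hg
  refine ⟨max d e + 1, fun m => ?_⟩
  have h₁ : (m + 2) ^ d ≤ (m + 2) ^ max d e := Nat.pow_le_pow_right (by omega) (le_max_left _ _)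
  have h₂ : (m + 2) ^ e ≤ (m + 2) ^ max d e := Nat.pow_le_pow_right (by omega) (le_max_right _ _)
  have := hd m
  have := he m
  rw [pow_succ]
  nlinarith [Nat.zero_le ((m + 2) ^ max d e * m)]

theorem mul {f g : ℕ → ℕ} (hf : PolyBounded f) (hg : PolyBounded g) :
    PolyBounded fun m => f m * g m := by
  obtain ⟨d, hd⟩ := hf
  obtain ⟨e, he⟩ := hg
  exact ⟨d + e, fun m => (Nat.mul_le_mul (hd m) (he m)).trans_eq (pow_add _ _ _).symm⟩

theorem pow {f : ℕ → ℕ} (hf : PolyBounded f) (k : ℕ) : PolyBounded fun m => f m ^ k := by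
  obtain ⟨d, hd⟩ := hf
  exact ⟨d * k, fun m => (Nat.pow_le_pow_left (hd m) k).trans_eq (pow_mul _ _ _).symm⟩

theorem sum {ι : Type*} (s : Finset ι) {f : ι → ℕ → ℕ} (hf : ∀ i, PolyBounded (f i)) :
    PolyBounded fun m => ∑ i ∈ s, f i m := by
  classical
  induction s using Finset.induction_on with
  | empty => simpa using const 0
  | insert a s ha ih => simpa [Finset.sum_insert ha] using (hf a).add ih

theorem exists_lt_two_pow {f : ℕ → ℕ} (hf : PolyBounded f) :
    ∃ n, 0 < n ∧ f (2 * n + 1) < 2 ^ n := by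
  obtain ⟨d, hd⟩ := hf
  have h := tendsto_pow_const_div_const_pow_of_one_lt d (r := (2 : ℝ)) (by norm_num)
  -- The constant `5 ^ d` absorbs the argument: `2 * n + 3 ≤ 5 * n` for `n ≥ 1`.
  have h' := h.eventually (gt_mem_nhds (show (0 : ℝ) < 1 / 5 ^ d by positivity))
  obtain ⟨n, hn, hn0⟩ := (h'.and (Filter.eventually_gt_atTop 0)).exists
  refine ⟨n, hn0, (hd _).trans_lt ?_⟩
  have h₁ : (2 * n + 1 + 2) ^ d ≤ (5 * n) ^ d := Nat.pow_le_pow_left (by omega) d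
  refine h₁.trans_lt ?_
  rw [div_lt_div_iff₀ (by positivity) (by positivity), one_mul] at hn
  have : ((5 * n : ℕ) : ℝ) ^ d < 2 ^ n := by
    push_cast
    rw [mul_pow, mul_comm]
    exact hn
  exact_mod_cast this

end PolyBounded

/-! ### Rectangle covers and their closure properties -/

/-- `N` products `P i * Q i` contained in `L` capture every splitting `u ++ v` of every word of
`L` of length at most `m`. -/
def HasRectangleCover {A : Type} (L : Language A) (m N : ℕ) : Prop :=
  ∃ (ι : Type) (_ : Fintype ι) (P Q : ι → Language A), Fintype.card ι ≤ N ∧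
    (∀ i, ∀ u ∈ P i, ∀ v ∈ Q i, u ++ v ∈ L) ∧
    ∀ u v, u ++ v ∈ L → (u ++ v).length ≤ m → ∃ i, u ∈ P i ∧ v ∈ Q i

namespace HasRectangleCover

variable {A : Type} {L L₁ L₂ : Language A} {m N N₁ N₂ : ℕ}

theorem mono (h : HasRectangleCover L m N₁) (hN : N₁ ≤ N₂) : HasRectangleCover L m N₂ := by
  obtain ⟨ι, _, P, Q, hc, h⟩ := h
  exact ⟨ι, ‹_›, P, Q, hc.trans hN, h⟩

theorem one : HasRectangleCover (1 : Language A) m 1 := by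
  refine ⟨Unit, inferInstance, fun _ => 1, fun _ => 1, by simp, ?_, ?_⟩
  · simp [Language.mem_one]
  · simp [Language.mem_one]

theorem singleton (a : A) : HasRectangleCover ({[a]} : Language A) m 2 := by
  refine ⟨Bool, inferInstance, fun b => bif b then {[]} else {[a]},
    fun b => bif b then {[a]} else {[]}, by simp, ?_, ?_⟩
  · rintro (_ | _) u hu v hv <;> rw [show u = _ from hu, show v = _ from hv] <;> rfl
  · intro u v h _
    rcases List.append_eq_singleton_iff.1 (show u ++ v = [a] from h) with ⟨rfl, rfl⟩ | ⟨rfl, rfl⟩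
    · exact ⟨true, rfl, rfl⟩
    · exact ⟨false, rfl, rfl⟩

/-- The cut falls inside one of the two factors, and the other factor is attached whole to the outer
side of a rectangle. So the numbers add rather than multiply. -/
theorem mul (h₁ : HasRectangleCover L₁ m N₁) (h₂ : HasRectangleCover L₂ m N₂) :
    HasRectangleCover (L₁ * L₂) m (N₁ + N₂) := by
  obtain ⟨ι, _, P, Q, hN, hPQ, hL⟩ := h₁
  obtain ⟨κ, _, R, S, hN', hRS, hL'⟩ := h₂
  refine ⟨ι ⊕ κ, inferInstance, Sum.elim P fun k => L₁ * R k, Sum.elim (fun i => Q i * L₂) S,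
    by simpa using Nat.add_le_add hN hN', ?_, ?_⟩
  · rintro (i | k) u hu v hv
    · obtain ⟨a, ha, b, hb, rfl⟩ := Language.mem_mul.1 hv
      exact Language.mem_mul.2 ⟨u ++ a, hPQ i u hu a ha, b, hb, by simp⟩
    · obtain ⟨a, ha, b, hb, rfl⟩ := Language.mem_mul.1 hu
      exact Language.mem_mul.2 ⟨a, ha, b ++ v, hRS k b hb v hv, by simp⟩
  · intro u v h hm
    obtain ⟨a, ha, b, hb, hab⟩ := Language.mem_mul.1 h
    rw [← hab, List.length_append] at hm
    rcases List.append_eq_append_iff.1 hab with ⟨c, rfl, rfl⟩ | ⟨c, rfl, rfl⟩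
    · obtain ⟨k, hk, hk'⟩ := hL' c v hb (by omega)
      exact ⟨.inr k, Language.append_mem_mul ha hk, hk'⟩
    · obtain ⟨i, hi, hi'⟩ := hL u c ha (by omega)
      exact ⟨.inl i, hi, Language.append_mem_mul hi' hb⟩

theorem list_prod (l : List (Language A)) (h : ∀ L ∈ l, HasRectangleCover L m N) :
    HasRectangleCover l.prod m (l.length * N + 1) := by
  induction l with
  | nil => simpa using one
  | cons L l ih =>
    rw [List.prod_cons]
    refine ((h L (by simp)).mul (ih fun L' hL' => h L' (by simp [hL']))).mono ?_
    simp only [List.length_cons, Nat.add_mul]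
    omega

theorem pow (h : HasRectangleCover L m N) (n : ℕ) : HasRectangleCover (L ^ n) m (n * N + 1) := by
  simpa using list_prod (List.replicate n L) fun L' hL' => List.eq_of_mem_replicate hL' ▸ h

/-- A language that is covered on short words by finitely many of its sublanguages. -/
theorem of_sublanguages {τ : Type} [Fintype τ] (F : τ → Language A)
    (hF : ∀ t, HasRectangleCover (F t) m N) (hle : ∀ t, ∀ w ∈ F t, w ∈ L)
    (hL : ∀ w ∈ L, w.length ≤ m → ∃ t, w ∈ F t) :
    HasRectangleCover L m (Fintype.card τ * N) := by
  choose ι inst P Q hN hPQ hcov using hF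
  refine ⟨Σ t, ι t, inferInstance, fun i => P i.1 i.2, fun i => Q i.1 i.2, ?_, ?_, ?_⟩
  · rw [Fintype.card_sigma]
    refine (Finset.sum_le_card_nsmul _ _ N fun t _ => hN t).trans_eq ?_
    simp
  · exact fun i u hu v hv => hle _ _ (hPQ i.1 i.2 u hu v hv)
  · intro u v h hm
    obtain ⟨t, ht⟩ := hL _ h hm
    obtain ⟨i, hi⟩ := hcov t u v ht hm
    exact ⟨⟨t, i⟩, hi⟩

theorem add (h₁ : HasRectangleCover L₁ m N₁) (h₂ : HasRectangleCover L₂ m N₂) :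
    HasRectangleCover (L₁ + L₂) m (2 * (N₁ + N₂)) := by
  -- `of_sublanguages` wants one bound for both summands; this costs the harmless factor 2.
  have := of_sublanguages (L := L₁ + L₂) (m := m) (N := N₁ + N₂)
    (fun b : Bool => bif b then L₁ else L₂) ?_ ?_ ?_
  · simpa using this
  · rintro (_ | _)
    · exact h₂.mono (by omega)
    · exact h₁.mono (by omega)
  · rintro (_ | _) w hw
    · exact Or.inr hw
    · exact Or.inl hw
  · rintro w (hw | hw) _
    · exact ⟨true, hw⟩
    · exact ⟨false, hw⟩

/-- Some factor `a ++ b` contains the cut. An empty list would have no such factor. -/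
theorem _root_.Language.exists_split_of_flatten_eq {l : List (List A)} (hl : l ≠ [])
    (h : ∀ y ∈ l, y ∈ L) {u v : List A} (huv : u ++ v = l.flatten) :
    ∃ p ∈ KStar.kstar L, ∃ a b, a ++ b ∈ L ∧ ∃ q ∈ KStar.kstar L, u = p ++ a ∧ v = b ++ q := by
  induction l generalizing u with
  | nil => exact absurd rfl hl
  | cons y l ih =>
    have hy : y ∈ L := h y (by simp)
    have hl' : ∀ z ∈ l, z ∈ L := fun z hz => h z (by simp [hz])
    rw [List.flatten_cons] at huv
    rcases List.append_eq_append_iff.1 huv with ⟨c, rfl, rfl⟩ | ⟨c, rfl, hc⟩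
    · exact ⟨[], Language.nil_mem_kstar L, u, c, hy, l.flatten, Language.join_mem_kstar hl',
        by simp, rfl⟩
    -- With no factors left, the cut is at the right end of `y`, and the induction hypothesis is not
    -- available.
    · by_cases hne : l = []
      · subst hne
        obtain ⟨rfl, rfl⟩ : c = [] ∧ v = [] := by simpa using hc.symm
        exact ⟨[], Language.nil_mem_kstar L, y, [], by simpa using hy, [],
          Language.nil_mem_kstar L, by simp, rfl⟩
      · obtain ⟨p, hp, a, b, hab, q, hq, rfl, rfl⟩ := ih hne hl' hc.symm
        obtain ⟨l', rfl, hl''⟩ := Language.mem_kstar.1 hp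
        refine ⟨y ++ l'.flatten, Language.mem_kstar.2 ⟨y :: l', by simp, ?_⟩, a, b, hab, q, hq,
          by simp, rfl⟩
        simpa [hy] using hl''

/-- Only the factor containing the cut needs a rectangle; all factors before and after it are
absorbed by Kleene stars. Hence the number does not grow with the number of factors. -/
theorem mul_kstar (h : HasRectangleCover L m N) :
    HasRectangleCover (L * KStar.kstar L) m N := by
  obtain ⟨ι, _, P, Q, hN, hPQ, hL⟩ := h
  refine ⟨ι, ‹_›, fun i => KStar.kstar L * P i, fun i => Q i * KStar.kstar L, hN, ?_, ?_⟩
  · intro i u hu v hv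
    obtain ⟨p, hp, a, ha, rfl⟩ := Language.mem_mul.1 hu
    obtain ⟨b, hb, q, hq, rfl⟩ := Language.mem_mul.1 hv
    have : (p ++ (a ++ b)) ++ q ∈ KStar.kstar L * L * KStar.kstar L :=
      Language.append_mem_mul (Language.append_mem_mul hp (hPQ i a ha b hb)) hq
    rw [Language.mul_self_kstar_comm, mul_assoc, kstar_mul_kstar] at this
    simpa using this
  · intro u v h hm
    obtain ⟨y, hy, z, hz, hyz⟩ := Language.mem_mul.1 h
    obtain ⟨l, rfl, hl⟩ := Language.mem_kstar.1 hz
    obtain ⟨p, hp, a, b, hab, q, hq, rfl, rfl⟩ :=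
      Language.exists_split_of_flatten_eq (L := L) (l := y :: l) (by simp)
        (by simpa [hy] using hl) (by rw [← hyz]; simp)
    obtain ⟨i, hi, hi'⟩ := hL a b hab (by simp only [List.length_append] at hm ⊢; omega)
    exact ⟨i, Language.append_mem_mul hp hi, Language.append_mem_mul hi' hq⟩

end HasRectangleCover

/-! ### Polynomial covers for J languages -/

/-- `L` has covers by products whose number grows polynomially with the length bound. -/
def HasPolyCovers {A : Type} (L : Language A) : Prop :=
  ∃ f, PolyBounded f ∧ ∀ m, HasRectangleCover L m (f m)

namespace JExpr

variable {A : Type}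

theorem nil_notMem_prod {l : List (Language A)} (h : ∃ L ∈ l, [] ∉ L) : [] ∉ l.prod := by
  induction l with
  | nil => simp at h
  | cons L l ih =>
    rw [List.prod_cons]
    intro hmem
    obtain ⟨a, ha, b, hb, hab⟩ := Language.mem_mul.1 hmem
    obtain ⟨rfl, rfl⟩ := List.append_eq_nil_iff.1 hab
    obtain ⟨L', hL', hn⟩ := h
    rcases List.mem_cons.1 hL' with rfl | hL'
    · exact hn ha
    · exact ih ⟨L', hL', hn⟩ hb

theorem length_le_of_mem_pow {L : Language A} (hL : [] ∉ L) {n : ℕ} {w : List A}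
    (hw : w ∈ L ^ n) : n ≤ w.length := by
  induction n generalizing w with
  | zero => simp
  | succ n ih =>
    rw [pow_succ] at hw
    obtain ⟨a, ha, b, hb, rfl⟩ := Language.mem_mul.1 hw
    have : b ≠ [] := fun h => hL (h ▸ hb)
    have := List.length_pos_iff.2 this
    have := ih ha
    rw [List.length_append]
    omega

theorem _root_.JExponent.val_pos (ν : ℕ → ℕ+) (e : JExponent) : 0 < e.val ν := by
  cases e <;> exact PNat.pos _

/-- Exponents are positive, so the empty word can arise only if every factor contains it. Without
union or closure this descends through the whole expression, leaving nothing but `ε`. -/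
theorem UnionPlusFree.language_eq_one {α : JExpr A} (hα : α.UnionPlusFree)
    (h : [] ∈ α.language) : α.language = 1 := by
  induction α with
  | eps => rfl
  | sym a => exact absurd (show [] = [a] from h) (by simp)
  | union => exact hα.elim
  | concat α β ihα ihβ =>
    obtain ⟨a, ha, b, hb, hab⟩ := Language.mem_mul.1 (show [] ∈ α.language * β.language from h)
    obtain ⟨rfl, rfl⟩ := List.append_eq_nil_iff.1 hab
    change α.language * β.language = 1
    rw [ihα hα.1 ha, ihβ hα.2 hb, one_mul]
  | plus => exact hα.elim
  | expo k β n ih =>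
    obtain ⟨ν, hν⟩ := h
    have hβ : ∀ j, (β j).language = 1 := by
      intro j
      by_contra hj
      have hnil : [] ∉ (β j).language := fun h' => hj (ih j (hα j) h')
      refine nil_notMem_prod ⟨_, List.mem_ofFn.2 ⟨j, rfl⟩, fun h' => ?_⟩ hν
      have := length_le_of_mem_pow hnil h'
      have := (n j).val_pos ν
      simp at *
      omega
    have hone : ∀ ν, (List.ofFn fun j => (β j).language ^ (n j).val ν).prod = 1 := fun ν =>
      List.prod_eq_one fun L hL => by
        obtain ⟨j, rfl⟩ := List.mem_ofFn.1 hL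
        simp [hβ j]
    ext w
    change (∃ ν : ℕ → ℕ+, w ∈ (List.ofFn fun j => (β j).language ^ (n j).val ν).prod) ↔ _
    simp only [hone, exists_const]

theorem mem_prod_ofFn_of_forall {k m : ℕ} {F G : Fin k → Language A}
    (h : ∀ j, ∀ x ∈ F j, x.length ≤ m → x ∈ G j) {w : List A} (hw : w ∈ (List.ofFn F).prod)
    (hm : w.length ≤ m) : w ∈ (List.ofFn G).prod := by
  induction k generalizing w with
  | zero => simpa using hw
  | succ k ih =>
    rw [List.ofFn_succ, List.prod_cons] at hw ⊢
    obtain ⟨a, ha, b, hb, rfl⟩ := Language.mem_mul.1 hw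
    rw [List.length_append] at hm
    exact Language.append_mem_mul (h 0 a ha (by omega))
      (ih (fun j => h j.succ) hb (by omega))

/-- The fixed exponent, or zero for a variable. -/
def _root_.JExponent.constPart : JExponent → ℕ
  | .const n => n
  | .var _ => 0

/-- If the base contains the empty word, all its powers equal 1. Otherwise each factor contributes a
letter, so the exponent is at most `m` and the cap does not affect it. The cap acts on the
assignment, so equal variables stay equal; it is `m + 1` in order to be positive when `m = 0`. -/
theorem mem_pow_val_min {α : JExpr A} (hα : α.UnionPlusFree) (e : JExponent) (ν : ℕ → ℕ+)
    {m : ℕ} {x : List A} (hx : x ∈ α.language ^ e.val ν) (hm : x.length ≤ m) :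
    x ∈ α.language ^ e.val fun v => min (ν v) m.succPNat := by
  by_cases hnil : [] ∈ α.language
  · rw [hα.language_eq_one hnil] at hx ⊢
    simpa using hx
  · have hle := (length_le_of_mem_pow hnil hx).trans hm
    cases e with
    | const n => exact hx
    | var v =>
      have : min (ν v) m.succPNat = ν v :=
        min_eq_left (PNat.coe_le_coe _ _ |>.1 (hle.trans (by simp)))
      simpa [JExponent.val, this] using hx

theorem val_min_le (e : JExponent) (ν : ℕ → ℕ+) (m : ℕ) :
    (e.val fun v => min (ν v) m.succPNat) ≤ m + 1 + e.constPart := by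
  cases e with
  | const n => simp [JExponent.val, JExponent.constPart]
  | var v =>
    have : ((min (ν v) m.succPNat : ℕ+) : ℕ) ≤ (m.succPNat : ℕ) :=
      PNat.coe_le_coe _ _ |>.2 (min_le_right _ _)
    simpa [JExponent.val, JExponent.constPart] using this

/-- On words of length at most `m` the variables may be capped at `m + 1`, so the language is a
union of polynomially many products with fixed exponents, each having polynomially many factors. -/
theorem hasPolyCovers_expo {k : ℕ} {β : Fin (k + 1) → JExpr A} (n : Fin (k + 1) → JExponent)
    (hβ : ∀ j, (β j).UnionPlusFree) (h : ∀ j, HasPolyCovers (β j).language) :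
    HasPolyCovers (expo k β n).language := by
  classical
  choose f hf hcov using h
  set K := ∑ j, (n j).constPart with hK
  have hB : PolyBounded fun m => m + (K + 2) := .add .id (.const _)
  have hF : PolyBounded fun m => ∑ j, f j m := .sum _ hf
  refine ⟨fun m => (m + (K + 2)) ^ (k + 1) *
      ((k + 1) * ((m + (K + 2)) * (∑ j, f j m) + 1) + 1),
    .mul (.pow hB _) (.add (.mul (.const _) (.add (.mul hB hF) (.const _))) (.const _)),
    fun m => ?_⟩
  -- Only tuples realised by an assignment are kept, so that each product lies in the language even
  -- when variables repeat. Capped values are at most `m + 1 + K`, hence the range `Fin (m + (K +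
  -- 2))`.
  let τ := {e : Fin (k + 1) → Fin (m + (K + 2)) //
    ∃ ν : ℕ → ℕ+, ∀ j, (e j : ℕ) = (n j).val ν}
  have hτ : Fintype.card τ ≤ (m + (K + 2)) ^ (k + 1) := by
    simpa using Fintype.card_subtype_le
      fun e : Fin (k + 1) → Fin (m + (K + 2)) => ∃ ν : ℕ → ℕ+, ∀ j, (e j : ℕ) = (n j).val ν
  refine (HasRectangleCover.of_sublanguages
    (fun e : τ => (List.ofFn fun j => (β j).language ^ (e.1 j : ℕ)).prod)
    (N := (k + 1) * ((m + (K + 2)) * (∑ j, f j m) + 1) + 1) ?_ ?_ ?_).mono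
      (Nat.mul_le_mul_right _ hτ)
  · intro e
    have := HasRectangleCover.list_prod (m := m) (N := (m + (K + 2)) * (∑ j, f j m) + 1)
      (List.ofFn fun j => (β j).language ^ (e.1 j : ℕ)) ?_
    · simpa using this
    · intro L hL
      obtain ⟨j, rfl⟩ := List.mem_ofFn.1 hL
      refine ((hcov j m).pow _).mono (Nat.add_le_add_right (Nat.mul_le_mul (e.1 j).2.le ?_) 1)
      exact Finset.single_le_sum (f := fun j => f j m) (fun _ _ => Nat.zero_le _)
        (Finset.mem_univ j)
  · rintro ⟨e, ν, hν⟩ w hw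
    refine ⟨ν, ?_⟩
    simpa only [hν] using hw
  · rintro w ⟨ν, hw⟩ hm
    refine ⟨⟨fun j => ⟨(n j).val fun v => min (ν v) m.succPNat, ?_⟩, _, fun j => rfl⟩, ?_⟩
    · have h₁ := val_min_le (n j) ν m
      have h₂ : (n j).constPart ≤ K :=
        Finset.single_le_sum (f := fun j => (n j).constPart) (fun _ _ => Nat.zero_le _)
          (Finset.mem_univ j)
      omega
    · exact mem_prod_ofFn_of_forall (fun j x hx hxm => mem_pow_val_min (hβ j) (n j) ν hx hxm) hw hm

theorem IsJ.hasPolyCovers {α : JExpr A} (hα : α.IsJ) : HasPolyCovers α.language := by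
  induction α with
  | eps => exact ⟨_, .const 1, fun _ => .one⟩
  | sym a => exact ⟨_, .const 2, fun _ => .singleton a⟩
  | union α β ihα ihβ =>
    obtain ⟨f, hf, hf'⟩ := ihα hα.1
    obtain ⟨g, hg, hg'⟩ := ihβ hα.2
    exact ⟨_, .mul (.const 2) (.add hf hg), fun m => (hf' m).add (hg' m)⟩
  | concat α β ihα ihβ =>
    obtain ⟨f, hf, hf'⟩ := ihα hα.1.1
    obtain ⟨g, hg, hg'⟩ := ihβ hα.2.1
    exact ⟨_, .add hf hg, fun m => (hf' m).mul (hg' m)⟩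
  | plus α ih =>
    obtain ⟨f, hf, hf'⟩ := ih hα.1
    exact ⟨f, hf, fun m => (hf' m).mul_kstar⟩
  | expo k β n ih => exact hasPolyCovers_expo n (fun j => (hα j).2) fun j => ih j (hα j).1

end JExpr

/-! ### Finite chains of steps and the range of the work head -/

theorem Relation.reflTransGen_iff_exists_nat_chain {α : Type*} {r : α → α → Prop} {a b : α} :
    Relation.ReflTransGen r a b ↔
      ∃ (t : ℕ) (c : ℕ → α), c 0 = a ∧ (∀ i < t, r (c i) (c (i + 1))) ∧ c t = b := by
  constructor
  · intro h
    induction h with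
    | refl => exact ⟨0, fun _ => a, rfl, by simp, rfl⟩
    | @tail b d _ hs ih =>
      obtain ⟨t, c, h₀, hc, rfl⟩ := ih
      refine ⟨t + 1, fun i => if i ≤ t then c i else d, by simpa using h₀, fun i hi => ?_, by simp⟩
      rcases Nat.lt_succ_iff_lt_or_eq.1 hi with hi | rfl
      · simpa [hi.le, Nat.succ_le_of_lt hi] using hc i hi
      · simpa using hs
  · rintro ⟨t, c, rfl, hc, rfl⟩
    induction t with
    | zero => exact .refl
    | succ t ih => exact (ih fun i hi => hc i (by omega)).tail (hc t (by omega))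

/-- A path with steps of size at most 1 visits every integer between its start and its current
position, and that interval has `|h i| + 1` points. -/
theorem Int.natAbs_lt_card_image_range {h : ℕ → ℤ} (h₀ : h 0 = 0) {t : ℕ}
    (hs : ∀ i < t, ∃ m : SignType, h (i + 1) = h i + (m : ℤ)) {i : ℕ} (hi : i ≤ t) :
    (h i).natAbs < ((Finset.range (t + 1)).image h).card := by
  have key : ∀ i ≤ t, Finset.uIcc 0 (h i) ⊆ (Finset.range (t + 1)).image h := by
    intro i hi
    induction i with
    | zero =>
      intro z hz
      rw [h₀, Finset.uIcc_self, Finset.mem_singleton] at hz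
      exact Finset.mem_image.2 ⟨0, by simp, by rw [h₀, hz]⟩
    | succ i ih =>
      intro z hz
      by_cases hzi : z = h (i + 1)
      · exact Finset.mem_image.2 ⟨i + 1, Finset.mem_range.2 (by omega), hzi.symm⟩
      · refine ih (by omega) ?_
        obtain ⟨m, hm⟩ := hs i (by omega)
        rw [Finset.mem_uIcc] at hz ⊢
        rw [hm] at hz hzi
        rcases m with _ | _ | _ <;> simp at hz hzi ⊢ <;> omega
  have := Finset.card_le_card (key i hi)
  rw [Int.card_uIcc] at this
  omega

/-! ### One-way Turing machines in logarithmic space -/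

namespace OneWayNTM

variable {A : Type} {M : OneWayNTM A}

/-- The work head is within distance `S` of the origin, and all work cells beyond that distance
are blank. -/
def Config.Within (S : ℕ) (C : M.Config) : Prop :=
  C.head.natAbs ≤ S ∧ ∀ z : ℤ, S < z.natAbs → C.tape z = M.blank

/-- A step to a configuration within distance `S`. -/
def BddStep (M : OneWayNTM A) (S : ℕ) (C D : M.Config) : Prop :=
  M.Step C D ∧ D.Within S

theorem within_initial (w : List A) (S : ℕ) : (M.initial w).Within S := by
  simp [Config.Within, initial]

theorem IsAcceptingRun.exists_bddSteps {w : List A} {t : ℕ} {c : ℕ → M.Config}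
    (h : M.IsAcceptingRun w t c) {S : ℕ} (hS : cellsUsed t c ≤ S) :
    ∃ D, Relation.ReflTransGen (M.BddStep S) (M.initial w) D ∧ D.state ∈ M.accepting := by
  obtain ⟨h₀, hs, ha⟩ := h
  have hhead : ∀ i ≤ t, (c i).head.natAbs ≤ S := fun i hi =>
    (Int.natAbs_lt_card_image_range (h := fun i => (c i).head) (by simp [h₀, initial])
      (fun i hi => by obtain ⟨b, m, adv, -, -, -, hm⟩ := hs i hi; exact ⟨m, hm⟩) hi).le.trans hS
  have hw : ∀ i ≤ t, (c i).Within S := by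
    intro i hi
    induction i with
    | zero => rw [h₀]; exact within_initial w S
    | succ i ih =>
      refine ⟨hhead _ hi, fun z hz => ?_⟩
      obtain ⟨b, m, adv, -, -, htape, -⟩ := hs i (by omega)
      rw [htape, Function.update_of_ne]
      · exact (ih (by omega)).2 z hz
      · rintro rfl
        exact absurd (hhead i (by omega)) (by omega)
  exact ⟨c t, Relation.reflTransGen_iff_exists_nat_chain.2
    ⟨t, c, h₀, fun i hi => ⟨hs i hi, hw _ hi⟩, rfl⟩, ha⟩

theorem mem_language_of_steps {w : List A} {D : M.Config}
    (h : Relation.ReflTransGen M.Step (M.initial w) D) (hD : D.state ∈ M.accepting) :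
    w ∈ M.language := by
  obtain ⟨t, c, h₀, hs, rfl⟩ := Relation.reflTransGen_iff_exists_nat_chain.1 h
  exact ⟨t, c, h₀, hs, hD⟩

/-- The configuration with the unread input replaced by `w`. -/
def Config.withRest (C : M.Config) (w : List A) : M.Config :=
  { C with rest := w }

/-- A computation that starts with `u ++ v` to be read either reaches a configuration with
exactly `v` unread, or never looks at `v`. -/
theorem cut {S : ℕ} {C D : M.Config} (h : Relation.ReflTransGen (M.BddStep S) C D)
    (hC : C.Within S) {u v : List A} (hr : C.rest = u ++ v) :
    (∃ E : M.Config, E.Within S ∧ E.rest = v ∧ Relation.ReflTransGen M.Step E D ∧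
      ∀ v', Relation.ReflTransGen M.Step (C.withRest (u ++ v')) (E.withRest v')) ∨
    ∀ v', ∃ D' : M.Config, Relation.ReflTransGen M.Step (C.withRest (u ++ v')) D' ∧
      D'.state = D.state := by
  induction h using Relation.ReflTransGen.head_induction_on generalizing u with
  | refl =>
    -- Acceptance does not require reading the whole input, so the run may stop before `v` is
    -- reached.
    exact .inr fun v' => ⟨_, .refl, rfl⟩
  | @head C C' hs hD ih =>
    rcases u with _ | ⟨a, u⟩
    · exact .inl ⟨C, hC, hr, .head hs.1 (Relation.ReflTransGen.mono (r := M.BddStep S) (fun _ _ h => h.1) _ _ hD), fun v' => .refl⟩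
    obtain ⟨b, m, adv, htr, hrest, htape, hhead⟩ := hs.1
    -- While `a` is scanned, a step depends only on `a`, so it survives any change of `v`.
    obtain ⟨u₁, hu₁, hstep⟩ : ∃ u₁ : List A, C'.rest = u₁ ++ v ∧
        ∀ v', M.Step (C.withRest (a :: u ++ v')) (C'.withRest (u₁ ++ v')) := by
      rw [hr] at htr hrest
      refine ⟨if adv then u else a :: u, ?_, fun v' => ⟨b, m, adv, htr, ?_, htape, hhead⟩⟩
      · rw [hrest]
        cases adv <;> rfl
      · cases adv <;> rfl
    rcases ih hs.2 hu₁ with ⟨E, hE, hEr, hED, hCE⟩ | hnever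
    · exact .inl ⟨E, hE, hEr, hED, fun v' => .head (hstep v') (hCE v')⟩
    · refine .inr fun v' => ?_
      obtain ⟨D', hD', hst⟩ := hnever v'
      exact ⟨D', .head (hstep v') hD', hst⟩

/-- Configurations within distance `S`, without the unread input. -/
abbrev Window (M : OneWayNTM A) (S : ℕ) : Type :=
  M.State × (Finset.Icc (-S : ℤ) S → M.Work) × Finset.Icc (-S : ℤ) S

/-- The configuration described by a window and an unread input. -/
noncomputable def Window.toConfig {S : ℕ} (x : M.Window S) (w : List A) : M.Config :=
  ⟨x.1, w, fun z => if hz : z ∈ Finset.Icc (-S : ℤ) S then x.2.1 ⟨z, hz⟩ else M.blank, x.2.2⟩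

theorem Config.Within.exists_window {S : ℕ} {C : M.Config} (hC : C.Within S) :
    ∃ x : M.Window S, ∀ w, x.toConfig w = C.withRest w := by
  obtain ⟨hh, ht⟩ := hC
  refine ⟨⟨C.state, fun z => C.tape z, ⟨C.head, Finset.mem_Icc.2 (by omega)⟩⟩, fun w => ?_⟩
  simp only [Window.toConfig, withRest, Config.mk.injEq, true_and, and_true]
  funext z
  split_ifs with hz
  · rfl
  · rw [Finset.mem_Icc] at hz
    exact (ht z (by omega)).symm

/-- Rectangles are indexed by the window at the moment when exactly `v` is unread, with `none` for
runs that never look at `v`. Gluing two half runs needs no space bound, because `M.language` imposes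
none. -/
theorem hasRectangleCover {L : Language A} (hL : M.language = L) {m S : ℕ}
    (h : ∀ w ∈ L, w.length ≤ m → ∃ t c, M.IsAcceptingRun w t c ∧ cellsUsed t c ≤ S) :
    HasRectangleCover L m
      (Nat.card M.State * (Nat.card M.Work ^ (2 * S + 1) * (2 * S + 1)) + 1) := by
  classical
  have := M.finiteState
  have := M.finiteWork
  have := Fintype.ofFinite M.State
  have := Fintype.ofFinite M.Work
  refine ⟨Option (M.Window S), inferInstance,
    fun o => o.elim
      {u | ∀ v', ∃ D : M.Config, Relation.ReflTransGen M.Step (M.initial (u ++ v')) D ∧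
        D.state ∈ M.accepting}
      fun x => {u | ∀ v', Relation.ReflTransGen M.Step (M.initial (u ++ v')) (x.toConfig v')},
    fun o => o.elim Set.univ
      fun x => {v | ∃ D : M.Config, Relation.ReflTransGen M.Step (x.toConfig v) D ∧
        D.state ∈ M.accepting}, ?_, ?_, ?_⟩
  · have hc : (2 * S + 1 : ℕ) = Fintype.card (Finset.Icc (-S : ℤ) S) := by
      rw [Fintype.card_coe, Int.card_Icc]
      omega
    simp only [Fintype.card_option, Fintype.card_prod, Nat.card_eq_fintype_card, hc,
      Fintype.card_fun, le_refl]
  · subst hL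
    rintro (_ | x) u hu v hv
    · obtain ⟨D, hD, hacc⟩ := hu v
      exact mem_language_of_steps hD hacc
    · obtain ⟨D, hD, hacc⟩ := hv
      exact mem_language_of_steps ((hu v).trans hD) hacc
  · intro u v huv hm
    obtain ⟨t, c, hrun, hS⟩ := h _ huv hm
    obtain ⟨D, hD, hacc⟩ := hrun.exists_bddSteps hS
    rcases cut hD (within_initial _ S) rfl with ⟨E, hE, rfl, hED, hCE⟩ | hnever
    · obtain ⟨x, hx⟩ := hE.exists_window
      refine ⟨some x, fun v' => ?_, D, ?_, hacc⟩
      · rw [hx]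
        exact hCE v'
      · rw [hx]
        exact hED
    · refine ⟨none, fun v' => ?_, trivial⟩
      obtain ⟨D', hD', hst⟩ := hnever v'
      exact ⟨D', hD', hst ▸ hacc⟩

/-- With `c ≤ 2 ^ c`, the power becomes one of `2 ^ (log m + 1)`, which is linear in `m`. -/
theorem polyBounded_pow_log (c k : ℕ) :
    PolyBounded fun m => c ^ (k * (Nat.log 2 m + 1)) := by
  refine .mono (.pow (.add (.mul (.const 2) .id) (.const 2)) (c * k)) fun m => ?_
  calc c ^ (k * (Nat.log 2 m + 1)) ≤ (2 ^ c) ^ (k * (Nat.log 2 m + 1)) :=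
        Nat.pow_le_pow_left Nat.lt_two_pow_self.le _
    _ = (2 ^ (Nat.log 2 m + 1)) ^ (c * k) := by
        rw [← pow_mul, ← pow_mul]
        ring_nf
    _ ≤ (2 * m + 2) ^ (c * k) := by
        refine Nat.pow_le_pow_left ?_ _
        rcases Nat.eq_zero_or_pos m with rfl | hm
        · simp
        · have := Nat.pow_log_le_self 2 hm.ne'
          rw [pow_succ]
          omega

theorem AcceptsInLogSpace.hasPolyCovers {L : Language A} (h : M.AcceptsInLogSpace L) :
    HasPolyCovers L := by
  obtain ⟨hL, C, hC⟩ := h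
  refine ⟨_, ?_, fun m => hasRectangleCover hL (S := C * (Nat.log 2 m + 1)) fun w hw hm => ?_⟩
  · have hS : PolyBounded fun m => 2 * (C * (Nat.log 2 m + 1)) + 1 :=
      .mono (.add (.mul (.const 2) (.mul (.const C) (.add .id (.const 1)))) (.const 1))
        fun m => by have := Nat.log_le_self 2 m; gcongr
    have hW : PolyBounded fun m => Nat.card M.Work ^ (2 * (C * (Nat.log 2 m + 1)) + 1) :=
      .mono (.mul (polyBounded_pow_log (Nat.card M.Work) (2 * C)) (.const (Nat.card M.Work)))
        fun m => by rw [pow_succ, mul_assoc]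
    exact .add (.mul (.const _) (.mul hW hS)) (.const 1)
  · obtain ⟨t, c, hrun, hS⟩ := hC w hw
    refine ⟨t, c, hrun, hS.trans ?_⟩
    have := Nat.log_mono_right (b := 2) hm
    gcongr

end OneWayNTM

/-! ### Linear-space multicounter machines -/

namespace LinearCounterMachine

variable {A : Type} {M : LinearCounterMachine A}

/-- A step to a configuration whose counters are at most `B`. -/
def BddStep (M : LinearCounterMachine A) (B : ℕ) (C D : M.Config) : Prop :=
  M.Step C D ∧ ∀ j, D.counter j ≤ B

/-- The configuration with the unread input replaced by `w`. -/
def Config.withRest (C : M.Config) (w : List A) : M.Config :=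
  { C with rest := w }

theorem mem_language_iff {w : List A} : w ∈ M.language ↔
    ∃ D : M.Config, Relation.ReflTransGen (M.BddStep w.length) (M.initial w) D ∧
      D.state ∈ M.final ∧ D.rest = [] ∧ ∀ j, D.counter j = 0 := by
  constructor
  · rintro ⟨t, c, h₀, hs, hb, hf⟩
    exact ⟨c t, Relation.reflTransGen_iff_exists_nat_chain.2
      ⟨t, c, h₀, fun i hi => ⟨hs i hi, hb (i + 1) hi⟩, rfl⟩, hf⟩
  · rintro ⟨D, hD, hf⟩
    obtain ⟨t, c, h₀, hs, rfl⟩ := Relation.reflTransGen_iff_exists_nat_chain.1 hD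
    refine ⟨t, c, h₀, fun i hi => (hs i hi).1, fun i hi => ?_, hf⟩
    rcases i with _ | i
    · simp [h₀, initial]
    · exact (hs i hi).2

/-- A computation that reads `u ++ v` reaches a configuration with exactly `v` unread. -/
theorem cut {B : ℕ} {C D : M.Config} (h : Relation.ReflTransGen (M.BddStep B) C D)
    (hD : D.rest = []) (hC : ∀ j, C.counter j ≤ B) {u v : List A} (hr : C.rest = u ++ v) :
    ∃ E : M.Config, (∀ j, E.counter j ≤ B) ∧ E.rest = v ∧
      Relation.ReflTransGen (M.BddStep B) E D ∧
      ∀ v', Relation.ReflTransGen (M.BddStep B) (C.withRest (u ++ v')) (E.withRest v') := by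
  induction h using Relation.ReflTransGen.head_induction_on generalizing u with
  | refl =>
    obtain ⟨rfl, rfl⟩ := List.append_eq_nil_iff.1 (hr.symm.trans hD)
    exact ⟨D, hC, hr, .refl, fun v' => .refl⟩
  | @head C C' hs hD ih =>
    rcases u with _ | ⟨a, u⟩
    · exact ⟨C, hC, hr, .head hs hD, fun v' => .refl⟩
    obtain ⟨o, δ, htr, hrest, hδ⟩ := hs.1
    obtain ⟨u₁, hu₁, hstep⟩ : ∃ u₁ : List A, C'.rest = u₁ ++ v ∧
        ∀ v', M.BddStep B (C.withRest (a :: u ++ v')) (C'.withRest (u₁ ++ v')) := by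
      rw [hr] at hrest
      rcases o with _ | b
      · exact ⟨a :: u, hrest.symm, fun v' => ⟨⟨none, δ, htr, rfl, hδ⟩, hs.2⟩⟩
      · obtain ⟨rfl, h'⟩ : a = b ∧ u ++ v = C'.rest := by simpa using hrest
        exact ⟨u, h'.symm, fun v' => ⟨⟨some a, δ, htr, rfl, hδ⟩, hs.2⟩⟩
    obtain ⟨E, hE, hEr, hED, hCE⟩ := ih hs.2 hu₁
    exact ⟨E, hE, hEr, hED, fun v' => .head (hstep v') (hCE v')⟩

/-- The counter bound is the length of the whole word, so gluing must preserve it. The index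
therefore records the lengths of `u` and `v` besides the state and the counters at the cut. -/
theorem hasRectangleCover_language (M : LinearCounterMachine A) (m : ℕ) :
    HasRectangleCover M.language m
      ((m + 1) * ((m + 1) * (Nat.card M.State * (m + 1) ^ M.k))) := by
  classical
  have := M.finiteState
  have := Fintype.ofFinite M.State
  let conf (q : M.State) (f : Fin M.k → Fin (m + 1)) (w : List A) : M.Config :=
    ⟨q, w, fun j => f j⟩
  refine ⟨Fin (m + 1) × Fin (m + 1) × M.State × (Fin M.k → Fin (m + 1)), inferInstance,
    fun x => {u | u.length = x.1 ∧ ∀ v', Relation.ReflTransGen (M.BddStep (x.1 + x.2.1))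
      (M.initial (u ++ v')) (conf x.2.2.1 x.2.2.2 v')},
    fun x => {v | v.length = x.2.1 ∧ ∃ D : M.Config,
      Relation.ReflTransGen (M.BddStep (x.1 + x.2.1)) (conf x.2.2.1 x.2.2.2 v) D ∧
      D.state ∈ M.final ∧ D.rest = [] ∧ ∀ j, D.counter j = 0}, ?_, ?_, ?_⟩
  · simp
  · rintro x u ⟨hu, hu'⟩ v ⟨hv, D, hD, hf⟩
    refine mem_language_iff.2 ⟨D, ?_, hf⟩
    rw [List.length_append, hu, hv]
    exact (hu' v).trans hD
  · intro u v huv hm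
    obtain ⟨D, hD, hf⟩ := mem_language_iff.1 huv
    obtain ⟨E, hE, rfl, hED, hCE⟩ := cut hD hf.2.1 (by simp [initial]) rfl
    rw [List.length_append] at hm hE hED hCE
    exact ⟨⟨⟨u.length, by omega⟩, ⟨E.rest.length, by omega⟩, E.state,
      fun j => ⟨E.counter j, by have := hE j; omega⟩⟩, ⟨rfl, hCE⟩, rfl, D, hED, hf⟩

theorem hasPolyCovers_language (M : LinearCounterMachine A) : HasPolyCovers M.language := by
  have h : PolyBounded fun m => m + 1 := .add .id (.const 1)
  exact ⟨_, .mul h (.mul h (.mul (.const _) (.pow h _))), M.hasRectangleCover_language⟩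

end LinearCounterMachine

/-! ### Exponential lower bound for marked palindromes -/

theorem mem_markedPalindromes {w : List (Option Bool)} : w ∈ markedPalindromes ↔
    ∃ x : List Bool, x ≠ [] ∧ w = x.map some ++ none :: x.reverse.map some := by
  simp only [markedPalindromes, List.append_assoc]
  rfl

theorem map_some_append_none_cons_inj {x y : List Bool} {s t : List (Option Bool)}
    (h : x.map some ++ none :: s = y.map some ++ none :: t) : x = y ∧ s = t := by
  induction x generalizing y with
  | nil => cases y <;> simp_all
  | cons a x ih =>
    cases y with
    | nil => simp at h
    | cons b y =>
      simp only [List.map_cons, List.cons_append, List.cons.injEq, Option.some.injEq] at h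
      obtain ⟨rfl, h⟩ := h
      obtain ⟨rfl, hst⟩ := ih h
      exact ⟨rfl, hst⟩

/-- A fooling set: if `x` and `y` of length `n` use the same rectangle, then it also contains `x #
yᴿ`, which forces `x = y`. -/
theorem two_pow_le_of_hasRectangleCover {n N : ℕ} (hn : 0 < n)
    (h : HasRectangleCover markedPalindromes (2 * n + 1) N) : 2 ^ n ≤ N := by
  obtain ⟨ι, _, P, Q, hN, hPQ, hcov⟩ := h
  have hx : ∀ x : List.Vector Bool n, ∃ i,
      x.1.map some ∈ P i ∧ none :: x.1.reverse.map some ∈ Q i := by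
    intro x
    refine hcov _ _ (mem_markedPalindromes.2 ⟨x.1, ?_, rfl⟩) ?_
    · exact List.length_pos_iff.1 (x.2.symm ▸ hn)
    · simp [x.2]
      omega
  choose g hP hQ using hx
  have hg : Function.Injective g := by
    intro x y hxy
    obtain ⟨z, -, hz⟩ :=
      mem_markedPalindromes.1 (hPQ (g x) _ (hP x) _ (hxy ▸ hQ y))
    obtain ⟨h₁, h₂⟩ := map_some_append_none_cons_inj hz
    have h₃ := List.map_injective_iff.2 (Option.some_injective Bool) h₂
    exact Subtype.ext (h₁.trans (List.reverse_injective h₃).symm)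
  have := Fintype.card_le_of_injective g hg
  rw [card_vector, Fintype.card_bool] at this
  exact this.trans hN

theorem not_hasPolyCovers_markedPalindromes : ¬ HasPolyCovers markedPalindromes := by
  rintro ⟨f, hf, h⟩
  obtain ⟨n, hn, hlt⟩ := hf.exists_lt_two_pow
  exact hlt.not_ge (two_pow_le_of_hasRectangleCover hn (h _))

/-! ### A context-free grammar for marked palindromes -/

namespace MarkedPalindromeGrammar

/-- Sentential forms over the terminals `0`, `1`, `#` and a single nonterminal. -/
abbrev Form : Type :=
  List (Symbol (Option Bool) Unit)

/-- The letter `b` as a terminal symbol. -/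
abbrev bit (b : Bool) : Symbol (Option Bool) Unit :=
  .terminal (some b)

/-- The rule `S → b s b`. -/
def rule (s : Symbol (Option Bool) Unit) (b : Bool) : ContextFreeRule (Option Bool) Unit :=
  ⟨(), [bit b, s, bit b]⟩

open Classical in
/-- The rules `S → b S b` and `S → b # b`, for `b = 0, 1`. -/
noncomputable def rules : Finset (ContextFreeRule (Option Bool) Unit) :=
  Finset.univ.image (rule (.nonterminal ())) ∪ Finset.univ.image (rule (.terminal none))

theorem mem_rules {r : ContextFreeRule (Option Bool) Unit} :
    r ∈ rules ↔ ∃ b, rule (.nonterminal ()) b = r ∨ rule (.terminal none) b = r := by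
  simp only [rules, Finset.mem_union, Finset.mem_image, Finset.mem_univ, true_and, exists_or]

/-- One rewriting step. -/
def Produces (u v : Form) : Prop :=
  ∃ r ∈ rules, r.Rewrites u v

/-- `x`, then `s`, then the reverse of `x`. -/
def wrap (x : List Bool) (s : Symbol (Option Bool) Unit) : Form :=
  x.map bit ++ [s] ++ x.reverse.map bit

theorem wrap_concat (x : List Bool) (b : Bool) (s : Symbol (Option Bool) Unit) :
    wrap (x ++ [b]) s = x.map bit ++ [bit b, s, bit b] ++ x.reverse.map bit := by
  simp [wrap]

theorem nonterminal_notMem_map_bit (x : List Bool) : Symbol.nonterminal () ∉ x.map bit := by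
  simp

theorem append_nonterminal_inj {x y : List Bool} {p q : Form}
    (h : x.map bit ++ Symbol.nonterminal () :: y.map bit = p ++ Symbol.nonterminal () :: q) :
    p = x.map bit ∧ q = y.map bit := by
  rcases List.append_eq_append_iff.1 h with ⟨c, hc, hc'⟩ | ⟨c, hc, hc'⟩
  · rcases c with _ | ⟨s, c⟩
    · exact ⟨by simpa using hc, by simpa using hc'.symm⟩
    · obtain ⟨-, hc'⟩ := List.cons.inj hc'
      exact absurd (show Symbol.nonterminal () ∈ y.map bit by rw [hc']; simp)
        (nonterminal_notMem_map_bit y)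
  · rcases c with _ | ⟨s, c⟩
    · exact ⟨by simpa using hc.symm, by simpa using hc'⟩
    · obtain ⟨hs, -⟩ := List.cons.inj hc'
      exact absurd (show Symbol.nonterminal () ∈ x.map bit by rw [hc, hs]; simp)
        (nonterminal_notMem_map_bit x)

theorem produces_wrap {x : List Bool} {v : Form} (h : Produces (wrap x (.nonterminal ())) v) :
    ∃ b, v = wrap (x ++ [b]) (.nonterminal ()) ∨ v = wrap (x ++ [b]) (.terminal none) := by
  obtain ⟨r, hr, hrv⟩ := h
  obtain ⟨p, q, hpq, rfl⟩ := hrv.exists_parts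
  obtain ⟨rfl, rfl⟩ := append_nonterminal_inj (x := x) (y := x.reverse) (p := p) (q := q)
    (by simpa only [wrap, List.append_assoc, List.singleton_append] using hpq)
  obtain ⟨b, rfl | rfl⟩ := mem_rules.1 hr
  · exact ⟨b, .inl (wrap_concat _ _ _).symm⟩
  · exact ⟨b, .inr (wrap_concat _ _ _).symm⟩

theorem not_produces_wrap_terminal {x : List Bool} {v : Form} :
    ¬ Produces (wrap x (.terminal none)) v := by
  rintro ⟨r, -, hr⟩
  have := hr.nonterminal_input_mem
  simp [wrap] at this

/-- The invariant of derivations: the single nonterminal stays in the centre until it is replaced by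
`#`, after which no rule applies. That last rule also adds a letter on each side, hence `x ≠ []`. -/
theorem derives_cases {v : Form} (h : Relation.ReflTransGen Produces [.nonterminal ()] v) :
    ∃ x, v = wrap x (.nonterminal ()) ∨ x ≠ [] ∧ v = wrap x (.terminal none) := by
  induction h with
  | refl => exact ⟨[], .inl rfl⟩
  | tail _ hs ih =>
    obtain ⟨x, rfl | ⟨-, rfl⟩⟩ := ih
    · obtain ⟨b, rfl | rfl⟩ := produces_wrap hs
      · exact ⟨_, .inl rfl⟩
      · exact ⟨_, .inr ⟨by simp, rfl⟩⟩
    · exact (not_produces_wrap_terminal hs).elim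

theorem wrap_produces (x : List Bool) (b : Bool) {s : Symbol (Option Bool) Unit}
    (hs : s = .nonterminal () ∨ s = .terminal none) :
    Produces (wrap x (.nonterminal ())) (wrap (x ++ [b]) s) := by
  rw [wrap_concat]
  refine ⟨rule s b, mem_rules.2 ⟨b, ?_⟩, ContextFreeRule.rewrites_of_exists_parts _ _ _⟩
  rcases hs with rfl | rfl <;> simp

theorem derives_wrap (x : List Bool) :
    Relation.ReflTransGen Produces [.nonterminal ()] (wrap x (.nonterminal ())) := by
  induction x using List.reverseRecOn with
  | nil => exact .refl
  | append_singleton x b ih => exact ih.tail (wrap_produces x b (.inl rfl))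

theorem map_terminal_eq_wrap (x : List Bool) :
    (x.map some ++ none :: x.reverse.map some).map Symbol.terminal =
      wrap x (.terminal none) := by
  simp [wrap, Function.comp_def]

theorem derives_map_terminal_iff {w : List (Option Bool)} :
    Relation.ReflTransGen Produces [.nonterminal ()] (w.map Symbol.terminal) ↔
      w ∈ markedPalindromes := by
  rw [mem_markedPalindromes]
  constructor
  · intro h
    obtain ⟨x, hx | ⟨hx0, hx⟩⟩ := derives_cases h
    · have : (Symbol.nonterminal () : Symbol (Option Bool) Unit) ∈ w.map Symbol.terminal := by
        rw [hx]
        simp [wrap]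
      simp at this
    · exact ⟨x, hx0, List.map_injective_iff.2 (fun _ _ h => Symbol.terminal.inj h)
        (hx.trans (map_terminal_eq_wrap x).symm)⟩
  · rintro ⟨x, hx, rfl⟩
    rw [map_terminal_eq_wrap]
    -- The innermost letter `b` is produced together with `#` by the last rule.
    obtain ⟨y, b, rfl⟩ := (List.eq_nil_or_concat' x).resolve_left hx
    exact (derives_wrap y).tail (wrap_produces y b (.inr rfl))

end MarkedPalindromeGrammar

theorem isContextFree_markedPalindromes : markedPalindromes.IsContextFree :=
  ⟨⟨Unit, (), MarkedPalindromeGrammar.rules⟩,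
    Language.ext fun _ => MarkedPalindromeGrammar.derives_map_terminal_iff⟩

theorem mainTheorem6 :
    markedPalindromes.IsContextFree ∧
    ¬ IsJLanguage markedPalindromes ∧
    (¬ ∃ M : OneWayNTM (Option Bool), M.AcceptsInLogSpace markedPalindromes) ∧
    (¬ ∃ M : LinearCounterMachine (Option Bool), M.language = markedPalindromes) := by
  refine ⟨isContextFree_markedPalindromes, ?_, ?_, ?_⟩
  · rintro ⟨α, hα, h⟩
    exact not_hasPolyCovers_markedPalindromes (h ▸ hα.hasPolyCovers)
  · rintro ⟨M, hM⟩
    exact not_hasPolyCovers_markedPalindromes hM.hasPolyCovers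
  · rintro ⟨M, hM⟩
    exact not_hasPolyCovers_markedPalindromes (hM ▸ M.hasPolyCovers_language)
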